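/- All maps are continuous. A map $p:\widetilde X\to X$ is an $\mathbf{lpc}_0$-covering map if $\widetilde X$ is path connected and locally path connected and, for every path connected and locally path connected space $Y$, all points $y\in Y$, $\tilde x\in\widetilde X$ and every map $f:(Y,y)\to (X,p(\tilde x))$ with $f_*\pi_1(Y,y)\le p_*\pi_1(\widetilde X,\tilde x)$, there is a unique map $\tilde f:(Y,y)\to(\widetilde X,\tilde x)$ with $p\circ\tilde f=f$. For a subgroup $H\le\pi_1(X,x_0)$, the space $X$ is strong $H$-SLT (strong $H$-small loop transfer) at $x_0$ if for every $x\in X$ and every open neighborhood $U$ of $x_0$ there is an open neighborhood $V$ of $x$ such that for every loop $\beta$ in $V$ based at $x$ and every path $\alpha$ in $X$ from $x_0$ to $x$ there is a loop $\lambda$ in $U$ based at $x_0$ with $[\alpha*\beta*\alpha^{-1}*\lambda^{-1}]\in H$. **Proposition 2.5.** Let $X$ be a path connected and locally path connected space, let $p:\widetilde X\to X$ be an $\mathbf{lpc}_0$-covering map, let $\tilde x_0\in\widetilde X$ with $p(\tilde x_0)=x_0$, and put $H=p_*\pi_1(\widetilde X,\tilde x_0)\le\pi_1(X,x_0)$.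 Suppose that $X$ is strong $H$-SLT at $x_0$. If the fiber $p^{-1}(x_0)$ is finite, then $p$ is a (surjective) covering map. -/

import Mathlib

universe u

/-- A continuous map `p : E → X` is an `lpc₀`-covering map if `E` is path connected and locally
path connected and, for every path connected, locally path connected space `Y`, every `y : Y`,
every `e : E` and every continuous `f : (Y, y) → (X, p e)` with `f_* π₁(Y, y) ≤ p_* π₁(E, e)`,
there is a unique continuous lift `(Y, y) → (E, e)` of `f` along `p`. -/
structure IsLpcCoveringMap {E X : Type u} [TopologicalSpace E] [TopologicalSpace X]
    (p : C(E, X)) : Prop where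
  pathConnected : PathConnectedSpace E
  locPathConnected : LocallyPathConnectedSpace E
  existsUnique_lift : ∀ (Y : Type u) [TopologicalSpace Y] [PathConnectedSpace Y]
    [LocallyPathConnectedSpace Y] (y : Y) (e : E) (f : C(Y, X)) (hf : f y = p e),
    (FundamentalGroup.mapOfEq f hf).range ≤ (FundamentalGroup.map p e).range →
      ∃! g : C(Y, E), g y = e ∧ p.comp g = f

/-- For paths `α`, `β` from `x₀` with a common endpoint: `[α]_H = [β]_H`, that is,
`[α * β⁻¹] ∈ H`. -/
def SameClassMod {X : Type u} [TopologicalSpace X] {x₀ x : X}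
    (H : Subgroup (FundamentalGroup X x₀)) (α β : Path x₀ x) : Prop :=
  FundamentalGroup.fromPath (Path.Homotopic.Quotient.mk (α.trans β.symm)) ∈ H

/-- `X` is a strong `H`-small loop transfer space at `x₀`. -/
def IsStrongSLTAt {X : Type u} [TopologicalSpace X] (x₀ : X)
    (H : Subgroup (FundamentalGroup X x₀)) : Prop :=
  ∀ (x : X) (U : Set X), IsOpen U → x₀ ∈ U →
    ∃ V : Set X, IsOpen V ∧ x ∈ V ∧
      ∀ β : Path x x, (∀ t, β t ∈ V) → ∀ α : Path x₀ x,
        ∃ l : Path x₀ x₀, (∀ t, l t ∈ U) ∧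
          SameClassMod H ((α.trans β).trans α.symm) l

open Topology unitInterval

universe v

namespace unitInterval

/-! The main point is that lifting is continuous at a point `e`: a path from `e` with small image in
`X` stays near `e`. To see this, glue all paths from `e` into one test space, the `Fan`, in which
almost all arcs (those with small image) lie near the initial points. It is contractible and locally
path connected, so its map to `X` lifts; unique path lifting identifies the lift on each arc with
the given path, and continuity at the initial points is the claim (`exists_nhds_forall_path_mem`).

Finiteness of the fibre gives `e₀` a neighbourhood that meets the fibre only in `e₀`, so small loops
at `x₀` lift to loops and lie in `H`. Strong `H`-SLT then puts `α * β * α⁻¹` in `H` for all small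
loops `β` at `x` and all `α`. Hence a path connected neighbourhood `V` of `x` has a section through
each point of the fibre, and the images of these sections are the sheets
(`isEvenlyCovered_of_sections`). -/

theorem locallyPathConnectedSpace : LocallyPathConnectedSpace I :=
  (isQuotientMap_projIcc (h := zero_le_one (α := ℝ))).locallyPathConnectedSpace

theorem contractibleSpace : ContractibleSpace I :=
  (convex_Icc (0 : ℝ) 1).contractibleSpace ⟨0, by simp⟩

end unitInterval

/-- The union of a family of arcs indexed by `J`, with inseparable initial points `(j, 0)`, in which
every neighbourhood of an initial point contains `l`-almost all of the arcs. -/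
def Fan {J : Type v} (_l : Filter J) : Type v := J × I

/-! ### The fan as a test space: local path connectedness and contractibility. -/

namespace Fan

variable {J : Type v} {l : Filter J}

/-- The point with parameter `t` on the arc with index `j`. -/
def ray (j : J) (t : I) : Fan l := (j, t)

@[elab_as_elim]
theorem ray_cases {motive : Fan l → Prop} (h : ∀ j t, motive (ray j t)) (y : Fan l) : motive y :=
  h y.1 y.2

instance : TopologicalSpace (Fan l) where
  IsOpen O := (∀ j, IsOpen {t | (ray j t : Fan l) ∈ O}) ∧
    ∀ j, (ray j 0 : Fan l) ∈ O → (∀ j', (ray j' 0 : Fan l) ∈ O) ∧ ∀ᶠ j' in l, ∀ t, (ray j' t : Fan l) ∈ O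
  isOpen_univ := ⟨fun _ ↦ isOpen_univ, fun _ _ ↦ ⟨fun _ ↦ trivial, .of_forall fun _ _ ↦ trivial⟩⟩
  isOpen_inter O O' h h' := ⟨fun j ↦ (h.1 j).inter (h'.1 j), fun j hj ↦
    ⟨fun j' ↦ ⟨(h.2 j hj.1).1 j', (h'.2 j hj.2).1 j'⟩,
      (h.2 j hj.1).2.mp <| (h'.2 j hj.2).2.mono fun _ h₁ h₂ t ↦ ⟨h₂ t, h₁ t⟩⟩⟩
  isOpen_sUnion S h := by
    refine ⟨fun j ↦ ?_, ?_⟩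
    · have : {t | (ray j t : Fan l) ∈ ⋃₀ S} = ⋃ O ∈ S, {t | (ray j t : Fan l) ∈ O} := by
        ext; simp
      rw [this]
      exact isOpen_biUnion fun O hO ↦ (h O hO).1 j
    · rintro j ⟨O, hO, hj⟩
      exact ⟨fun j' ↦ ⟨O, hO, ((h O hO).2 j hj).1 j'⟩,
        ((h O hO).2 j hj).2.mono fun _ h t ↦ ⟨O, hO, h t⟩⟩

theorem isOpen_iff {O : Set (Fan l)} : IsOpen O ↔ (∀ j, IsOpen {t | ray j t ∈ O}) ∧
    ∀ j, ray j 0 ∈ O → (∀ j', ray j' 0 ∈ O) ∧ ∀ᶠ j' in l, ∀ t, ray j' t ∈ O := Iff.rfl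

theorem continuous_ray (j : J) : Continuous (ray j : I → Fan l) :=
  ⟨fun _ hO ↦ (isOpen_iff.1 hO).1 j⟩

theorem continuous_of_ray {X : Type*} [TopologicalSpace X] {f : Fan l → X} {x : X}
    (hf : ∀ j, Continuous fun t ↦ f (ray j t)) (h0 : ∀ j, f (ray j 0) = x)
    (hx : ∀ U ∈ 𝓝 x, ∀ᶠ j in l, ∀ t, f (ray j t) ∈ U) : Continuous f := by
  refine ⟨fun U hU ↦ isOpen_iff.2 ⟨fun j ↦ hU.preimage (hf j), fun j hj ↦ ?_⟩⟩
  have hxU : x ∈ U := h0 j ▸ hj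
  exact ⟨fun j' ↦ by simpa [h0] using hxU, hx U (hU.mem_nhds hxU)⟩

theorem inseparable_ray_zero (j j' : J) : Inseparable (ray j 0 : Fan l) (ray j' 0) :=
  inseparable_iff_forall_isOpen.2 fun _ hO ↦
    ⟨fun h ↦ ((isOpen_iff.1 hO).2 j h).1 j', fun h ↦ ((isOpen_iff.1 hO).2 j' h).1 j⟩

/-- On a single arc, the open sets away from the initial point are open in the fan. -/
theorem isOpen_image_ray (j : J) {A : Set I} (hA : IsOpen A) (h0 : (0 : I) ∉ A) :
    IsOpen (ray j '' A : Set (Fan l)) := by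
  have key (j' t) : (ray j' t : Fan l) ∈ ray j '' A ↔ j' = j ∧ t ∈ A := by
    constructor
    · rintro ⟨s, hs, h⟩
      obtain ⟨rfl, rfl⟩ := Prod.mk.inj h
      exact ⟨rfl, hs⟩
    · rintro ⟨rfl, ht⟩
      exact ⟨t, ht, rfl⟩
  refine isOpen_iff.2 ⟨fun j' ↦ ?_, fun j' h ↦ absurd ((key _ _).1 h).2 h0⟩
  by_cases hj : j' = j <;> simp [key, hj, hA]

/-- An open set containing one initial point contains all of them and almost all whole arcs, which
can be reached through the initial points. -/
instance : LocallyPathConnectedSpace (Fan l) := by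
  have := unitInterval.locallyPathConnectedSpace
  have := unitInterval.contractibleSpace
  refine locallyPathConnectedSpace_iff_isOpen_pathComponentIn.2 fun y O hO ↦
    isOpen_iff.2 ⟨fun j ↦ ?_, fun j hj ↦ ?_⟩
  · refine isOpen_iff_mem_nhds.2 fun t ht ↦ ?_
    have hO' := hO.preimage (continuous_ray (l := l) j)
    refine Filter.mem_of_superset ((hO'.pathComponentIn t).mem_nhds
      (mem_pathComponentIn_self ht.target_mem)) fun s hs ↦ ?_
    exact JoinedIn.trans ht ((JoinedIn.map hs (continuous_ray j)).mono (Set.image_preimage_subset _ _))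
  · have hjO : ray j 0 ∈ O := hj.target_mem
    have h0 : ∀ j', JoinedIn O y (ray j' 0) := fun j' ↦ JoinedIn.trans hj
      ((inseparable_ray_zero j j').joinedIn hjO (((isOpen_iff.1 hO).2 j hjO).1 j'))
    refine ⟨h0, ((isOpen_iff.1 hO).2 j hjO).2.mono fun j' h t ↦ (h0 j').trans ?_⟩
    refine ((JoinedIn.map (F := Set.univ) (x := 0) (y := t) ?_ (continuous_ray j')).mono ?_)
    · exact joinedIn_univ.2 (PathConnectedSpace.joined _ _)
    · rintro _ ⟨s, -, rfl⟩
      exact h s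

theorem continuous_scale :
    Continuous fun z : I × Fan l ↦ (ray z.2.1 (z.1 * z.2.2) : Fan l) := by
  refine ⟨fun O hO ↦ isOpen_iff_mem_nhds.2 ?_⟩
  rintro ⟨s, y⟩
  induction y using ray_cases with | h j t
  intro h
  replace h : ray j (s * t) ∈ O := h
  have hO1 := (isOpen_iff.1 hO).1
  by_cases ht : t = 0
  · subst ht
    have hj : ray j 0 ∈ O := by simpa using h
    obtain ⟨h0, hl⟩ := (isOpen_iff.1 hO).2 j hj
    -- These are the points whose whole segment back to the initial point lies in `O`; compactness
    -- of `I` makes the condition open along each arc.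
    have hN : IsOpen {y : Fan l | ∀ r : I, ray y.1 (r * y.2) ∈ O} := by
      refine isOpen_iff.2 ⟨fun j' ↦ ?_, fun j' _ ↦ ⟨fun j'' r ↦ ?_, hl.mono fun j'' h t r ↦ h _⟩⟩
      · refine isOpen_iff_mem_nhds.2 fun t ht ↦ ?_
        have := isCompact_univ.eventually_forall_of_forall_eventually (x₀ := t)
          (P := fun (t r : I) ↦ (ray j' (r * t) : Fan l) ∈ O) (K := Set.univ) fun r _ ↦
          (((hO1 j').preimage (f := fun z : I × I ↦ z.2 * z.1) (by fun_prop)).mem_nhds (ht r))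
        filter_upwards [this] with t ht r using ht r trivial
      · simpa [ray] using h0 j''
    filter_upwards [(hN.preimage continuous_snd).mem_nhds (x := (s, ray j 0)) fun r ↦ by
      simpa [ray] using hj] with z hz using hz z.1
  · have hm := ((hO1 j).preimage (f := fun z : I × I ↦ z.1 * z.2) (by fun_prop)).mem_nhds
      (x := (s, t)) h
    obtain ⟨A, B, hA, hsA, hB, htB, hAB⟩ := mem_nhds_prod_iff'.1 hm
    refine Filter.mem_of_superset ((hA.prod (isOpen_image_ray j (hB.inter isOpen_compl_singleton)
      fun h ↦ h.2 rfl)).mem_nhds (x := (s, ray j t)) ⟨hsA, t, ⟨htB, ht⟩, rfl⟩) ?_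
    rintro ⟨s', _⟩ ⟨hs', t', ht', rfl⟩
    exact hAB (Set.mk_mem_prod hs' ht'.1)

instance [Nonempty J] : ContractibleSpace (Fan l) := by
  classical
  obtain ⟨j₀⟩ := ‹Nonempty J›
  -- Arcs shrink to their own initial points. Moving the final values to the single point `ray j₀ 0`
  -- keeps continuity because initial points are inseparable.
  refine (contractible_iff_id_nullhomotopic _).2 ⟨ray j₀ 0, ⟨⟨⟨fun z ↦
    if z.1 = 1 then ray j₀ 0 else ray z.2.1 (σ z.1 * z.2.2), ⟨fun O hO ↦ ?_⟩⟩, ?_, ?_⟩⟩⟩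
  · have := hO.preimage (continuous_scale.comp
      (continuous_symm.prodMap continuous_id : Continuous (Prod.map σ (id : Fan l → Fan l))))
    convert this using 1
    ext ⟨s, y⟩
    by_cases hs : s = 1
    · simpa [hs] using (inseparable_ray_zero j₀ y.1).mem_open_iff hO
    · simp [hs]
  · intro y; simp; rfl
  · intro y; simp

end Fan

/-! ### Path lifting and the effect of a finite fibre. -/

namespace IsLpcCoveringMap

variable {E X : Type u} [TopologicalSpace E] [TopologicalSpace X] {p : C(E, X)}

theorem existsUnique_lift_of_simplyConnected (hp : IsLpcCoveringMap p) {Y : Type u}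
    [TopologicalSpace Y] [SimplyConnectedSpace Y] [LocallyPathConnectedSpace Y]
    (y : Y) (e : E) (f : C(Y, X)) (hf : f y = p e) : ∃! g : C(Y, E), g y = e ∧ p.comp g = f := by
  refine hp.existsUnique_lift Y y e f hf ?_
  rintro _ ⟨a, rfl⟩
  rw [Subsingleton.elim a 1, map_one]
  exact one_mem _

theorem existsUnique_path_lift (hp : IsLpcCoveringMap p) (e : E) (f : C(I, X)) (hf : f 0 = p e) :
    ∃! g : C(I, E), g 0 = e ∧ p.comp g = f := by
  have := unitInterval.locallyPathConnectedSpace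
  have := unitInterval.contractibleSpace
  have : ContractibleSpace (ULift.{u} I) := Homeomorph.ulift.contractibleSpace
  have : LocallyPathConnectedSpace (ULift.{u} I) :=
    Homeomorph.ulift.isOpenEmbedding.locallyPathConnectedSpace
  obtain ⟨g, ⟨hg0, hg⟩, huniq⟩ := hp.existsUnique_lift_of_simplyConnected (Y := ULift.{u} I)
    ⟨0⟩ e (f.comp ⟨ULift.down, continuous_uliftDown⟩) hf
  refine ⟨g.comp ⟨ULift.up, continuous_uliftUp⟩, ⟨hg0, ?_⟩, ?_⟩
  · ext t
    exact DFunLike.congr_fun hg ⟨t⟩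
  · rintro g' ⟨hg'0, hg'⟩
    have := huniq (g'.comp ⟨ULift.down, continuous_uliftDown⟩) ⟨hg'0, by rw [← hg']; rfl⟩
    rw [← this]
    rfl

theorem path_lift_unique (hp : IsLpcCoveringMap p) {g g' : C(I, E)} (h0 : g 0 = g' 0)
    (h : ∀ t, p (g t) = p (g' t)) : g = g' :=
  (hp.existsUnique_path_lift (g' 0) (p.comp g') rfl).unique ⟨h0, ContinuousMap.ext h⟩ ⟨rfl, rfl⟩

theorem surjective [PathConnectedSpace X] (hp : IsLpcCoveringMap p) : Function.Surjective p := by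
  intro x
  have := hp.pathConnected
  obtain ⟨e⟩ : Nonempty E := inferInstance
  obtain ⟨γ⟩ := PathConnectedSpace.joined (p e) x
  obtain ⟨g, ⟨-, hg⟩, -⟩ := hp.existsUnique_path_lift e γ.toContinuousMap γ.source
  exact ⟨g 1, (DFunLike.congr_fun hg 1).trans γ.target⟩

/-- Distinct points of a fibre are topologically distinguishable. -/
theorem eq_of_specializes (hp : IsLpcCoveringMap p) {e e' : E} (h : e ⤳ e') (hpe : p e = p e') :
    e = e' := by
  -- A path inside the fibre joins the two points; it lies over a constant path, so unique lifting
  -- makes it constant.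
  obtain ⟨γ, hγ⟩ := h.joinedIn (F := p ⁻¹' {p e}) rfl hpe.symm
  have := hp.path_lift_unique (g := γ.toContinuousMap) (g' := .const I e) γ.source hγ
  simpa using (DFunLike.congr_fun this 1).symm

/-- Paths from `e` whose image in the base is small enough stay close to `e`. -/
theorem exists_nhds_forall_path_mem (hp : IsLpcCoveringMap p) (e : E) {W : Set E} (hW : W ∈ 𝓝 e) :
    ∃ U ∈ 𝓝 (p e), ∀ g : C(I, E), g 0 = e → (∀ t, p (g t) ∈ U) → ∀ t, g t ∈ W := by
  let J := {g : C(I, E) // g 0 = e}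
  -- A set of paths is large when it contains every path with image in some neighbourhood of `p e`.
  let l : Filter J := (𝓝 (p e)).smallSets.comap fun g ↦ Set.range fun t ↦ p (g.1 t)
  let j₀ : J := ⟨.const I e, rfl⟩
  have : Nonempty J := ⟨j₀⟩
  let f : C(Fan l, X) := ⟨fun y ↦ p (y.1.1 y.2), Fan.continuous_of_ray (x := p e)
    (fun j ↦ p.continuous.comp j.1.continuous) (fun j ↦ congrArg p j.2) fun U hU ↦ by
      refine Filter.eventually_comap.2 (Filter.eventually_smallSets.2 ⟨U, hU, ?_⟩)
      rintro S hS j rfl t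
      exact hS ⟨t, rfl⟩⟩
  obtain ⟨g, ⟨hg0, hg⟩, -⟩ := hp.existsUnique_lift_of_simplyConnected (Fan.ray j₀ 0) e f rfl
  have hg0' (j : J) : g (Fan.ray j 0) = e := by
    have h := (Fan.inseparable_ray_zero (l := l) j j₀).map g.continuous
    exact (hp.eq_of_specializes h.specializes
      ((DFunLike.congr_fun hg _).trans ((congrArg p (j.2.trans j₀.2.symm)).trans
        (DFunLike.congr_fun hg (Fan.ray j₀ 0)).symm))).trans hg0
  have hray (j : J) (t : I) : g (Fan.ray j t) = j.1 t :=
    DFunLike.congr_fun (hp.path_lift_unique (g := g.comp ⟨_, Fan.continuous_ray j⟩) (g' := j.1)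
      ((hg0' j).trans j.2.symm) fun t ↦ DFunLike.congr_fun hg (Fan.ray j t)) t
  obtain ⟨O, hOW, hO, heO⟩ := mem_nhds_iff.1 hW
  have hl := ((Fan.isOpen_iff.1 (hO.preimage g.continuous)).2 j₀ (by simpa [hg0])).2
  obtain ⟨U, hU, h⟩ := Filter.eventually_smallSets.1 (Filter.eventually_comap.1 hl)
  refine ⟨U, hU, fun c hc hcU t ↦ hOW ?_⟩
  have := h _ (Set.range_subset_iff.2 hcU) ⟨c, hc⟩ rfl t
  rwa [Set.mem_preimage, hray] at this

/-- No other point of the fibre specializes to `e`, so each is missed by some open set around `e`;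
finitely many such sets are intersected. -/
theorem exists_isOpen_inter_fiber (hp : IsLpcCoveringMap p) (e : E) (hfin : (p ⁻¹' {p e}).Finite) :
    ∃ W, IsOpen W ∧ e ∈ W ∧ ∀ e' ∈ W, p e' = p e → e' = e := by
  have key : ∀ e' ∈ p ⁻¹' {p e}, ∃ W, IsOpen W ∧ e ∈ W ∧ (e' ∈ W → e' = e) := fun e' he' ↦ by
    by_cases h : e' ⤳ e
    · exact ⟨Set.univ, isOpen_univ, trivial, fun _ ↦ hp.eq_of_specializes h he'⟩
    · rw [specializes_iff_forall_open] at h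
      push Not at h
      obtain ⟨W, hW, he, he'⟩ := h
      exact ⟨W, hW, he, fun h ↦ absurd h he'⟩
  choose! W hW heW heq using key
  exact ⟨⋂ e' ∈ p ⁻¹' {p e}, W e', hfin.isOpen_biInter hW, Set.mem_iInter₂.2 heW,
    fun e' he' h ↦ heq e' h (Set.mem_iInter₂.1 he' e' h)⟩

/-- If the fibre of `p e` is finite, then small loops at `p e` lift to loops at `e`. -/
theorem exists_isOpen_forall_loop_mem_range (hp : IsLpcCoveringMap p) (e : E)
    (hfin : (p ⁻¹' {p e}).Finite) :
    ∃ U, IsOpen U ∧ p e ∈ U ∧ ∀ γ : Path (p e) (p e), (∀ t, γ t ∈ U) →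
      FundamentalGroup.fromPath (.mk γ) ∈ (FundamentalGroup.map p e).range := by
  obtain ⟨W, hW, heW, hWe⟩ := hp.exists_isOpen_inter_fiber e hfin
  obtain ⟨S, hS, h⟩ := hp.exists_nhds_forall_path_mem e (hW.mem_nhds heW)
  obtain ⟨U, hUS, hU, heU⟩ := mem_nhds_iff.1 hS
  refine ⟨U, hU, heU, fun γ hγ ↦ ?_⟩
  obtain ⟨g, ⟨hg0, hg⟩, -⟩ := hp.existsUnique_path_lift e γ.toContinuousMap γ.source
  have hg' (t) : p (g t) = γ t := DFunLike.congr_fun hg t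
  have hg1 : g 1 = e := hWe _ (h g hg0 (fun t ↦ hUS (hg' t ▸ hγ t)) 1) (by simp [hg'])
  refine ⟨FundamentalGroup.fromPath (.mk ⟨g, hg0, hg1⟩), ?_⟩
  have : Path.map ⟨g, hg0, hg1⟩ p.continuous = γ := Path.ext (funext hg')
  exact congrArg Path.Homotopic.Quotient.mk this

end IsLpcCoveringMap

/-- If `η` is a loop at `e` lying over the conjugate up to homotopy, then `γ⁻¹ * η * γ` lies over
`β` up to homotopy. -/
theorem mem_range_map_of_conj_mem {E X : Type*} [TopologicalSpace E] [TopologicalSpace X]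
    (p : C(E, X)) {e e' : E} (γ : Path e e') (β : Path (p e') (p e'))
    (h : FundamentalGroup.fromPath (.mk (((γ.map p.continuous).trans β).trans
      (γ.map p.continuous).symm)) ∈ (FundamentalGroup.map p e).range) :
    FundamentalGroup.fromPath (.mk β) ∈ (FundamentalGroup.map p e').range := by
  obtain ⟨a, ha⟩ := h
  induction a using Path.Homotopic.Quotient.ind with | mk η
  refine ⟨FundamentalGroup.fromPath (.mk (γ.symm.trans (η.trans γ))), ?_⟩
  change Path.Homotopic.Quotient.mk (η.map p.continuous) = _ at ha
  change Path.Homotopic.Quotient.mk ((γ.symm.trans (η.trans γ)).map p.continuous) = .mk β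
  simp only [Path.map_trans, ← Path.map_symm, Path.Homotopic.Quotient.mk_trans,
    Path.Homotopic.Quotient.mk_symm] at ha ⊢
  rw [ha]
  simp only [Path.Homotopic.Quotient.trans_assoc, Path.Homotopic.Quotient.symm_trans,
    Path.Homotopic.Quotient.trans_refl]
  rw [← Path.Homotopic.Quotient.trans_assoc, Path.Homotopic.Quotient.symm_trans,
    Path.Homotopic.Quotient.refl_trans]

theorem FundamentalGroup.mapOfEq_rfl {X Y : Type*} [TopologicalSpace X] [TopologicalSpace Y]
    (f : C(X, Y)) (x : X) : FundamentalGroup.mapOfEq f (rfl : f x = f x) = FundamentalGroup.map f x := by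
  ext a
  simp [FundamentalGroup.mapOfEq_apply]

/-- A map with unique path lifting is a trivial covering over a path connected open set over which
there are sections through all points of a fibre. -/
theorem isEvenlyCovered_of_sections {E X : Type*} [TopologicalSpace E] [TopologicalSpace X]
    [LocallyPathConnectedSpace E] (p : C(E, X))
    (huniq : ∀ g g' : C(I, E), g 0 = g' 0 → (∀ t, p (g t) = p (g' t)) → g = g')
    {V : Set X} (hV : IsOpen V) (hVc : IsPathConnected V) {x : X} (hx : x ∈ V)
    (hne : (p ⁻¹' {x}).Nonempty)
    (hlift : ∀ f : C(I, X), ∀ e, f 0 = p e → ∃ g : C(I, E), g 0 = e ∧ ∀ t, p (g t) = f t)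
    (hs : ∀ e, p e = x → ∃ s : C(V, E), s ⟨x, hx⟩ = e ∧ ∀ v, p (s v) = v) :
    IsEvenlyCovered p x (p ⁻¹' {x}) := by
  choose s hsx hps using fun e : p ⁻¹' {x} ↦ hs e e.2
  have : Nonempty (p ⁻¹' {x}) := hne.to_subtype
  have : Nonempty (X → E) := ⟨fun _ ↦ hne.some⟩
  -- A path over `V` that starts on a sheet stays on it. With local path connectedness of `E`, this
  -- makes the sheets open.
  have hpath (e) (g : C(I, E)) (hg : ∀ t, p (g t) ∈ V) {v} (hv : s e v = g 0) (t) :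
      g t = s e ⟨p (g t), hg t⟩ := by
    have hv' : v = ⟨p (g 0), hg 0⟩ := Subtype.ext ((hps e v).symm.trans (congrArg p hv))
    exact DFunLike.congr_fun (huniq g ((s e).comp ⟨fun t ↦ ⟨p (g t), hg t⟩, by fun_prop⟩)
      ((congrArg (s e) hv').symm.trans hv).symm (by simp [hps])) t
  have hopen (e) : IsOpen (Set.range (s e)) := by
    refine isOpen_iff_mem_nhds.2 ?_
    rintro _ ⟨v, rfl⟩
    have hVE : IsOpen (p ⁻¹' V) := hV.preimage p.continuous
    refine Filter.mem_of_superset ((hVE.pathComponentIn (s e v)).mem_nhds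
      (mem_pathComponentIn_self (by simp [hps]))) ?_
    rintro e' ⟨γ, hγ⟩
    have := hpath e γ.toContinuousMap hγ (v := v) γ.source.symm 1
    exact ⟨_, this.symm.trans γ.target⟩
  -- Two sheets that meet agree along a path in `V` to `x`, hence at the fibre over `x`.
  have hmeet {e e'} {v v'} (h : s e v = s e' v') : e = e' := by
    have hv : v = v' := Subtype.ext (by rw [← hps e, h, hps])
    subst hv
    obtain ⟨γ, hγ⟩ := hVc.joinedIn v v.2 x hx
    let c : C(I, V) := ⟨fun t ↦ ⟨γ t, hγ t⟩, by fun_prop⟩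
    have hc0 : c 0 = v := Subtype.ext γ.source
    have hc1 : c 1 = ⟨x, hx⟩ := Subtype.ext γ.target
    have := DFunLike.congr_fun (huniq ((s e).comp c) ((s e').comp c) (by simpa [hc0])
      (by simp [hps])) 1
    simp only [ContinuousMap.comp_apply, hc1, hsx] at this
    exact Subtype.ext this
  have hdisc : DiscreteTopology (p ⁻¹' {x}) := by
    refine discreteTopology_iff_isOpen_singleton.2 fun e ↦ ?_
    convert (hopen e).preimage continuous_subtype_val using 1
    ext e'
    constructor
    · rintro rfl
      exact ⟨_, hsx _⟩
    · rintro ⟨v, hv⟩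
      exact (hmeet (hv.trans (hsx e').symm)).symm
  refine IsEvenlyCovered.of_trivialization (t := IsOpen.trivializationDiscrete
    (fun e ↦ Set.range (s e)) V hV (fun e W hWV ↦ ⟨fun hW ↦
      (hW.preimage p.continuous).inter (hopen e), fun hW ↦ ?_⟩) ?_ ?_ ?_ ?_) hx
  · convert hV.isOpenMap_subtype_val _ (hW.preimage (s e).continuous) using 1
    ext w
    constructor
    · exact fun hw ↦ ⟨⟨w, hWV hw⟩, by simp [hps, hw], rfl⟩
    · rintro ⟨w, hw, rfl⟩
      simpa [hps] using hw
  · rintro e _ ⟨v, rfl⟩ _ ⟨v', rfl⟩ h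
    rw [hps, hps] at h
    rw [Subtype.ext h]
  · exact fun e v hv ↦ ⟨_, ⟨⟨v, hv⟩, rfl⟩, hps _ _⟩
  · refine fun e e' h ↦ Set.disjoint_left.2 ?_
    rintro _ ⟨v, rfl⟩ ⟨v', hv⟩
    exact h (hmeet hv.symm)
  · intro e he
    obtain ⟨γ, hγ⟩ := hVc.joinedIn (p e) he x hx
    obtain ⟨g, hg0, hg⟩ := hlift γ.toContinuousMap e γ.source
    have hg1 : p (g 1) = x := (hg 1).trans γ.target
    refine Set.mem_iUnion.2 ⟨⟨g 1, hg1⟩, ?_⟩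
    -- The lifted path is run backwards, from its end in the fibre over `x`, so it stays on the
    -- sheet of `g 1` and ends at `e`.
    have := hpath ⟨g 1, hg1⟩ (g.comp ⟨σ, continuous_symm⟩) (fun t ↦ by
      simpa [hg] using hγ (σ t)) (v := ⟨x, hx⟩) (by simp [hsx]) 1
    refine ⟨_, this.symm.trans (by simp [hg0])⟩

theorem proposition2p5 {E X : Type u} [TopologicalSpace E] [TopologicalSpace X]
    [PathConnectedSpace X] [LocallyPathConnectedSpace X]
    (p : C(E, X)) (hp : IsLpcCoveringMap p)
    (e₀ : E) (x₀ : X) (he₀ : p e₀ = x₀)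
    (H : Subgroup (FundamentalGroup X x₀))
    (hH : (FundamentalGroup.mapOfEq p he₀).range = H)
    (hX : IsStrongSLTAt x₀ H)
    (hfin : (p ⁻¹' {x₀}).Finite) :
    Function.Surjective p ∧ IsCoveringMap p := by
  have := hp.pathConnected
  have := hp.locPathConnected
  subst he₀
  rw [FundamentalGroup.mapOfEq_rfl] at hH
  subst hH
  obtain ⟨U, hU, heU, hUl⟩ := hp.exists_isOpen_forall_loop_mem_range e₀ hfin
  refine ⟨hp.surjective, fun x ↦ ?_⟩
  obtain ⟨V', hV', hxV', hloop⟩ := hX x U hU heU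
  let V := pathComponentIn V' x
  have hV : IsOpen V := hV'.pathComponentIn x
  have hVc : IsPathConnected V := isPathConnected_pathComponentIn hxV'
  have hxV : x ∈ V := mem_pathComponentIn_self hxV'
  refine isEvenlyCovered_of_sections p (fun _ _ ↦ hp.path_lift_unique) hV hVc hxV
    (hp.surjective x) (fun f e hf ↦ ?_) fun e he ↦ ?_
  · obtain ⟨g, ⟨hg0, hg⟩, -⟩ := hp.existsUnique_path_lift e f hf
    exact ⟨g, hg0, DFunLike.congr_fun hg⟩
  subst he
  have := isPathConnected_iff_pathConnectedSpace.1 hVc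
  have := hV.locallyPathConnectedSpace
  let i : C(V, X) := ⟨Subtype.val, continuous_subtype_val⟩
  suffices h : (FundamentalGroup.mapOfEq i (x := ⟨p e, hxV⟩) rfl).range ≤
      (FundamentalGroup.map p e).range by
    obtain ⟨s, ⟨hs0, hs⟩, -⟩ := hp.existsUnique_lift V ⟨p e, hxV⟩ e i rfl h
    exact ⟨s, hs0, DFunLike.congr_fun hs⟩
  rw [FundamentalGroup.mapOfEq_rfl]
  rintro _ ⟨a, rfl⟩
  induction a using Path.Homotopic.Quotient.ind with | mk b
  -- Small transfer is known only at the base point `p e₀`, so the loop is conjugated back there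
  -- along the image of a path in `E`.
  obtain ⟨γ⟩ := PathConnectedSpace.joined e₀ e
  refine mem_range_map_of_conj_mem p γ (b.map continuous_subtype_val) ?_
  obtain ⟨c, hcU, hc⟩ := hloop (b.map continuous_subtype_val)
    (fun t ↦ pathComponentIn_subset (b t).2) (γ.map p.continuous)
  have hcH := hUl c hcU
  -- Multiplication in `FundamentalGroup` reverses concatenation, so the factor `c` stands on the
  -- left.
  have : FundamentalGroup.fromPath (.mk (((γ.map p.continuous).trans
      (b.map continuous_subtype_val)).trans (γ.map p.continuous).symm)) =
      FundamentalGroup.fromPath (.mk c) * FundamentalGroup.fromPath (.mk ((((γ.map p.continuous).trans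
      (b.map continuous_subtype_val)).trans (γ.map p.continuous).symm).trans c.symm)) := by
    rw [FundamentalGroup.mul_def]
    simp [Path.Homotopic.Quotient.trans_assoc]
  rw [this]
  exact mul_mem hcH hc
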